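/- For a positive integer $n$ put $a_k(n)=n^k/k!$, $S_0(n)=\sum_{k=0}^{n-1} n^k/k!$, $p_k(n)=\dfrac{n!\,k}{(n-k)!\,n^{k+1}}$ for $1\le k\le n$, and $R_1(n)=\sum_{k=1}^n p_k(n)\,k$. Let $\tau(n)$ be the real number determined by Stirling's formula $n!=(n/e)^n\sqrt{2\pi n}\,e^{\tau(n)}$, and let $\sigma(n)$ be the real number determined by $\dfrac{e^n}{2}=S_0(n)+\left(\dfrac13+\sigma(n)\right)\dfrac{n^n}{n!}$. Then for every positive integer $n$ $$R_1(n)=\frac{n!}{n^n}S_0(n)=\sqrt{\frac{\pi n}{2}}-\frac13+\kappa(n),$$ where $$\kappa(n)=\sqrt{\frac{\pi n}{2}}\left(e^{\tau(n)}-1-\frac{2\sigma(n)e^{\tau(n)}}{e^n}\cdot\frac{n^n}{n!}\right),$$ which equals $\sqrt{\pi n/2}\,\bigl(e^{\tau(n)}-1\bigr)-\sigma(n)$. Moreover $\kappa$ is strictly decreasing, $\kappa(n+1)<\kappa(n)$ for all $n\ge 1$, and $\kappa(n)\to0$ as $n\to\infty$. -/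

import Mathlib

open Filter Topology
open scoped Nat

namespace RamanujanQ

noncomputable section

/-- `a_k(n) = n^k / k!`. -/
def a (n k : ℕ) : ℝ := (n : ℝ) ^ k / (k ! : ℝ)

/-- `S_i(n) = ∑_{k=0}^{n-1} a_k(n) k^i` (with `0^0 = 1`, so that `S_0(n) = ∑_{k<n} n^k / k!`). -/
def S (i n : ℕ) : ℝ := ∑ k ∈ Finset.range n, a n k * (k : ℝ) ^ i

/-- The probability `p_k(n) = n! k / ((n - k)! n^(k+1))`, used for `1 ≤ k ≤ n` only. -/
def p (n k : ℕ) : ℝ := (n ! : ℝ) * k / (((n - k) ! : ℝ) * (n : ℝ) ^ (k + 1))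

/-- `R_i(n) = ∑_{k=1}^{n} p_k(n) k^i`. -/
def R (i n : ℕ) : ℝ := ∑ k ∈ Finset.Icc 1 n, p n k * (k : ℝ) ^ i

/-- The error exponent `τ(n)` in Stirling's formula `n! = (n/e)^n √(2πn) e^{τ(n)}`;
it is the unique real number with this property, see `stirling_tau`. -/
def τ (n : ℕ) : ℝ :=
  Real.log ((n ! : ℝ) / (((n : ℝ) / Real.exp 1) ^ n * √(2 * Real.pi * n)))

/-- Szegő's `σ(n)`, the unique solution of `e^n / 2 = S_0(n) + (1/3 + σ(n)) a_n(n)`,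
see `szego_sigma`. -/
def σ (n : ℕ) : ℝ := (Real.exp n / 2 - S 0 n) / a n n - 1 / 3

/-- `κ(n) = √(πn/2) (e^τ - 1 - 2 σ e^τ a_n / e^n)`. -/
def κ (n : ℕ) : ℝ :=
  √(Real.pi * n / 2) *
    (Real.exp (τ n) - 1 - 2 * σ n * Real.exp (τ n) * a n n / Real.exp n)

theorem stirling_tau (n : ℕ) (hn : 1 ≤ n) :
    (n ! : ℝ) = ((n : ℝ) / Real.exp 1) ^ n * √(2 * Real.pi * n) * Real.exp (τ n) := by
  have hn' : (0 : ℝ) < n := by exact_mod_cast hn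
  have hf : (0 : ℝ) < (n ! : ℝ) := by exact_mod_cast Nat.factorial_pos n
  have hd : 0 < ((n : ℝ) / Real.exp 1) ^ n * √(2 * Real.pi * n) := by positivity
  rw [τ, Real.exp_log (div_pos hf hd), mul_div_cancel₀ _ hd.ne']

theorem szego_sigma (n : ℕ) (hn : 1 ≤ n) :
    Real.exp n / 2 = S 0 n + (1 / 3 + σ n) * a n n := by
  have hn' : (0 : ℝ) < n := by exact_mod_cast hn
  have ha : a n n ≠ 0 := by unfold a; positivity
  unfold σ
  field_simp
  ring

end

end RamanujanQ

/-!
With `h(t) = t - log (1 + t)`, expanding `(1 + t)^(n-1)` turns the sum of tail probabilities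
`R_1(n) = ∑ P(X ≥ k)` into `∫ ρ_n(t) / t dt`, where `ρ_x = x h' exp (-x h)` is a probability density
on the positive half-line. At the saddle point `t = 0` the coordinate `u = √(2 h)` satisfies
`1/t = 1/u - 1/3 + ψ` with `ψ → 0`. Since `∫ ρ_n / u = √(πn/2)` is a Gaussian integral and
`∫ ρ_n = 1`, Stirling's and Szegő's formulas identify `κ(n)` with `∫ ψ ρ_n`, and integration by
parts gives the Laplace transform `κ(n) = ∫ ψ'(t) exp (-n h(t)) dt`. Here `h > 0`, and `ψ' > 0`
because `(1 + t) u³ < t³`, which Bernoulli's inequality implies; so `κ` decreases strictly to `0`.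
-/

namespace RamanujanQ

open MeasureTheory Set

theorem sum_Icc_mul_sub_succ {A : Type*} [Ring A] (f : ℕ → A) (N : ℕ) :
    ∑ k ∈ Finset.Icc 1 N, (k : A) * (f k - f (k + 1)) =
      ∑ k ∈ Finset.Icc 1 N, f k - N * f (N + 1) := by
  induction N with
  | zero => simp
  | succ N ih =>
    rw [Finset.sum_Icc_succ_top (by omega), Finset.sum_Icc_succ_top (by omega), ih]
    push_cast
    noncomm_ring

section LaplaceTransform

variable {α : Type*} [MeasurableSpace α] {μ : Measure α} {f h : α → ℝ}

theorem integrable_mul_exp_neg_mul (hf : Integrable f μ) (hh : AEMeasurable h μ)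
    (h_nonneg : ∀ᵐ t ∂μ, 0 ≤ h t) {x : ℝ} (hx : 0 ≤ x) :
    Integrable (fun t => f t * Real.exp (-(x * h t))) μ := by
  refine hf.mul_bdd (c := 1) (by fun_prop) ?_
  filter_upwards [h_nonneg] with t ht
  rw [Real.norm_of_nonneg (Real.exp_nonneg _), Real.exp_le_one_iff, neg_nonpos]
  exact mul_nonneg hx ht

theorem strictAntiOn_integral_mul_exp_neg_mul [NeZero μ] (hf : Integrable f μ)
    (hh : AEMeasurable h μ) (f_pos : ∀ᵐ t ∂μ, 0 < f t) (h_pos : ∀ᵐ t ∂μ, 0 < h t) :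
    StrictAntiOn (fun x => ∫ t, f t * Real.exp (-(x * h t)) ∂μ) (Ici 0) := by
  intro x hx y hy hxy
  have hintegrable {z : ℝ} (hz : 0 ≤ z) :=
    integrable_mul_exp_neg_mul hf hh (h_pos.mono fun _ => le_of_lt) hz
  have hlt : ∀ᵐ t ∂μ, f t * Real.exp (-(y * h t)) < f t * Real.exp (-(x * h t)) := by
    filter_upwards [f_pos, h_pos] with t hft hht
    gcongr
  have hle := hlt.mono fun _ => le_of_lt
  refine (integral_mono_ae (hintegrable hy) (hintegrable hx) hle).lt_of_ne fun heq => ?_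
  have hae := (integral_eq_iff_of_ae_le (hintegrable hy) (hintegrable hx) hle).1 heq
  obtain ⟨t, hne, heq⟩ := (hlt.and hae).exists
  exact hne.ne heq

theorem tendsto_integral_mul_exp_neg_mul (hf : Integrable f μ) (hh : AEMeasurable h μ)
    (h_pos : ∀ᵐ t ∂μ, 0 < h t) :
    Tendsto (fun x : ℝ => ∫ t, f t * Real.exp (-(x * h t)) ∂μ) atTop (𝓝 0) := by
  rw [← integral_zero α ℝ (μ := μ)]
  refine tendsto_integral_filter_of_dominated_convergence (fun t => ‖f t‖) ?_ ?_ hf.norm ?_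
  · filter_upwards [eventually_ge_atTop 0] with x hx
    exact (integrable_mul_exp_neg_mul hf hh (h_pos.mono fun _ => le_of_lt) hx).aestronglyMeasurable
  · filter_upwards [eventually_ge_atTop 0] with x hx
    filter_upwards [h_pos] with t ht
    rw [norm_mul, Real.norm_of_nonneg (Real.exp_nonneg _)]
    refine mul_le_of_le_one_right (norm_nonneg _) (Real.exp_le_one_iff.2 ?_)
    exact neg_nonpos.2 (mul_nonneg hx ht.le)
  · filter_upwards [h_pos] with t ht
    have hexp := Real.tendsto_exp_neg_atTop_nhds_zero.comp (tendsto_id.atTop_mul_const ht)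
    simpa using hexp.const_mul (f t)

end LaplaceTransform

section PowMulExpNegMul

variable {x : ℝ}

theorem integrableOn_pow_mul_exp_neg_mul (hx : 0 < x) (j : ℕ) :
    IntegrableOn (fun t : ℝ => t ^ j * Real.exp (-(x * t))) (Ioi 0) := by
  simpa using integrableOn_rpow_mul_exp_neg_mul_rpow (s := j) (p := 1)
    (neg_one_lt_zero.trans_le j.cast_nonneg) one_pos hx

theorem integral_pow_mul_exp_neg_mul (hx : 0 < x) (j : ℕ) :
    ∫ t in Ioi (0 : ℝ), t ^ j * Real.exp (-(x * t)) = j ! / x ^ (j + 1) := by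
  have hgamma := Real.integral_rpow_mul_exp_neg_mul_Ioi (a := j + 1) (by positivity) hx
  rw [Real.Gamma_nat_eq_factorial, add_sub_cancel_right] at hgamma
  simp only [Real.rpow_natCast] at hgamma
  rw [hgamma, ← Nat.cast_add_one, Real.rpow_natCast, one_div, inv_pow, inv_mul_eq_div]

theorem integral_one_add_pow_mul_exp_neg_mul (hx : 0 < x) (m : ℕ) :
    ∫ t in Ioi (0 : ℝ), (1 + t) ^ m * Real.exp (-(x * t)) =
      ∑ j ∈ Finset.range (m + 1), m.descFactorial j / x ^ (j + 1) := by
  have hbinom (t : ℝ) : (1 + t) ^ m * Real.exp (-(x * t)) =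
      ∑ j ∈ Finset.range (m + 1), m.choose j * (t ^ j * Real.exp (-(x * t))) := by
    rw [add_comm, add_pow, Finset.sum_mul]
    exact Finset.sum_congr rfl fun j _ => by rw [one_pow]; ring
  simp only [hbinom]
  rw [integral_finsetSum _ fun j _ => (integrableOn_pow_mul_exp_neg_mul hx j).const_mul _]
  refine Finset.sum_congr rfl fun j _ => ?_
  rw [integral_const_mul, integral_pow_mul_exp_neg_mul hx,
    Nat.descFactorial_eq_factorial_mul_choose]
  push_cast
  ring

end PowMulExpNegMul

section DerivativeTests

variable {f f' : ℝ → ℝ} {c : ℝ}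

theorem lt_of_hasDerivAt_pos (hf : ContinuousOn f (Ici c))
    (hf' : ∀ x, c < x → HasDerivAt f (f' x) x) (f'_pos : ∀ x, c < x → 0 < f' x) {x : ℝ}
    (hx : c < x) : f c < f x := by
  refine strictMonoOn_of_hasDerivWithinAt_pos (f' := f') (convex_Ici c) hf ?_ ?_
    self_mem_Ici hx.le hx
  all_goals rw [interior_Ici]
  · exact fun y hy => (hf' y hy).hasDerivWithinAt
  · exact f'_pos

theorem integrableOn_Ioi_deriv_of_nonneg_of_tendsto {l l' : ℝ}
    (hf' : ∀ x ∈ Ioi c, HasDerivAt f (f' x) x) (f'_nonneg : ∀ x ∈ Ioi c, 0 ≤ f' x)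
    (hl : Tendsto f (𝓝[>] c) (𝓝 l)) (hl' : Tendsto f atTop (𝓝 l')) :
    IntegrableOn f' (Ioi c) := by
  -- `f c` may be a junk value; replacing it by the limit `l` makes `f` continuous at `c`.
  have hupdate {x : ℝ} (hx : c < x) : Function.update f c l =ᶠ[𝓝 x] f := by
    filter_upwards [eventually_ne_nhds hx.ne'] with y hy
    exact Function.update_of_ne hy l f
  refine integrableOn_Ioi_deriv_of_nonneg (g := Function.update f c l) ?_
    (fun x hx => (hf' x hx).congr_of_eventuallyEq (hupdate hx)) f'_nonneg (hl'.congr' ?_)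
  · rwa [continuousWithinAt_update_same, Ici_sdiff_left]
  · filter_upwards [eventually_gt_atTop c] with x hx
    exact (Function.update_of_ne hx.ne' l f).symm

end DerivativeTests

/-- The tail probability `P(X ≥ k)` of the distribution `P(X = k) = p n k` on `{1, …, n}`. -/
noncomputable def tailProb (n k : ℕ) : ℝ := n.descFactorial k / (n : ℝ) ^ k

theorem p_eq_tailProb_sub {n k : ℕ} (hn : 1 ≤ n) (hk : k ≤ n) :
    p n k = tailProb n k - tailProb n (k + 1) := by
  have hfac : (n ! : ℝ) = (n - k) ! * n.descFactorial k := by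
    exact_mod_cast (Nat.factorial_mul_descFactorial hk).symm
  have : (n : ℝ) ≠ 0 := by positivity
  rw [p, tailProb, tailProb, Nat.descFactorial_succ, hfac, Nat.cast_mul, Nat.cast_sub hk]
  field_simp
  ring

theorem tailProb_eq {n k : ℕ} (hn : 1 ≤ n) (hk : k ≤ n) :
    tailProb n k = n ! / (n : ℝ) ^ n * a n (n - k) := by
  have hfac : (n ! : ℝ) = (n - k) ! * n.descFactorial k := by
    exact_mod_cast (Nat.factorial_mul_descFactorial hk).symm
  have : (n : ℝ) ≠ 0 := by positivity
  rw [tailProb, a, hfac, ← pow_sub_mul_pow (n : ℝ) hk]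
  field_simp

theorem R_one_eq_sum_tailProb {n : ℕ} (hn : 1 ≤ n) :
    R 1 n = ∑ k ∈ Finset.Icc 1 n, tailProb n k := by
  have hlast : tailProb n (n + 1) = 0 := by simp [tailProb]
  calc R 1 n = ∑ k ∈ Finset.Icc 1 n, (k : ℝ) * (tailProb n k - tailProb n (k + 1)) :=
        Finset.sum_congr rfl fun k hk => by
          rw [p_eq_tailProb_sub hn (Finset.mem_Icc.1 hk).2, pow_one, mul_comm]
    _ = ∑ k ∈ Finset.Icc 1 n, tailProb n k := by
          rw [sum_Icc_mul_sub_succ, hlast, mul_zero, sub_zero]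

theorem R_one_eq_factorial_div_mul_S {n : ℕ} (hn : 1 ≤ n) :
    R 1 n = n ! / (n : ℝ) ^ n * S 0 n := by
  rw [R_one_eq_sum_tailProb hn, S, Finset.mul_sum]
  refine Finset.sum_nbij' (n - ·) (n - ·) ?_ ?_ ?_ ?_ ?_
  all_goals simp only [Finset.mem_Icc, Finset.mem_range, pow_zero, mul_one]
  any_goals omega
  exact fun k hk => tailProb_eq hn hk.2

theorem factorial_div_pow_mul_exp {n : ℕ} (hn : 1 ≤ n) :
    n ! / (n : ℝ) ^ n * Real.exp n = 2 * √(Real.pi * n / 2) * Real.exp (τ n) := by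
  have hsqrt : √(2 * Real.pi * n) = 2 * √(Real.pi * n / 2) := by
    rw [show 2 * Real.pi * n = 2 ^ 2 * (Real.pi * n / 2) by ring,
      Real.sqrt_mul (by positivity), Real.sqrt_sq zero_le_two]
  rw [stirling_tau n hn, hsqrt, div_pow, Real.exp_one_pow]
  field_simp

theorem kappa_eq {n : ℕ} (hn : 1 ≤ n) :
    κ n = √(Real.pi * n / 2) * (Real.exp (τ n) - 1) - σ n := by
  have hone : 2 * √(Real.pi * n / 2) * Real.exp (τ n) * (a n n / Real.exp n) = 1 := by
    rw [← factorial_div_pow_mul_exp hn, a]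
    field_simp
  rw [κ]
  linear_combination (-σ n) * hone

theorem R_one_eq_sqrt_sub_add_kappa {n : ℕ} (hn : 1 ≤ n) :
    R 1 n = √(Real.pi * n / 2) - 1 / 3 + κ n := by
  have hszego := szego_sigma n hn
  have hstirling := factorial_div_pow_mul_exp hn
  have hone : (n ! : ℝ) / (n : ℝ) ^ n * a n n = 1 := by
    rw [a]
    field_simp
  rw [R_one_eq_factorial_div_mul_S hn, kappa_eq hn]
  linear_combination (-(n ! : ℝ) / (n : ℝ) ^ n) * hszego + hstirling / 2 - (1 / 3 + σ n) * hone

/-- The phase `h(t) = t - log (1 + t)` of the Laplace integral `∫ exp (-n h(t)) / (1 + t) dt`. -/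
noncomputable def logGap (t : ℝ) : ℝ := t - Real.log (1 + t)

theorem measurable_logGap : Measurable logGap := by
  unfold logGap
  fun_prop

theorem logGap_zero : logGap 0 = 0 := by simp [logGap]

theorem logGap_pos {t : ℝ} (ht : 0 < t) : 0 < logGap t := by
  have := Real.log_lt_sub_one_of_pos (x := 1 + t) (by linarith) (by linarith)
  unfold logGap
  linarith

theorem hasDerivAt_logGap {t : ℝ} (ht : -1 < t) : HasDerivAt logGap (t / (1 + t)) t := by
  have ht₁ : 1 + t ≠ 0 := by linarith
  refine ((hasDerivAt_id t).sub (((hasDerivAt_id t).const_add 1).log ht₁)).congr_deriv ?_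
  simp only [id]
  field_simp
  ring

theorem tendsto_logGap_atTop : Tendsto logGap atTop atTop := by
  refine tendsto_atTop_mono' (f₁ := fun t => t / 2 - Real.log 2) atTop ?_
    (tendsto_atTop_add_const_right _ _ (tendsto_id.atTop_div_const two_pos))
  filter_upwards [eventually_ge_atTop 0] with t ht
  have hlog := Real.log_le_sub_one_of_pos (x := (1 + t) / 2) (by linarith)
  rw [Real.log_div (by linarith) two_ne_zero] at hlog
  unfold logGap
  linarith

-- The comparison function `3t / (3 + t)` is `u` as given by the expansion `1/u = 1/t + 1/3 + O(t)`.
theorem sq_lt_two_mul_logGap {t : ℝ} (ht : 0 < t) : (3 * t / (3 + t)) ^ 2 < 2 * logGap t := by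
  have hderiv (x : ℝ) (hx : 0 ≤ x) :
      HasDerivAt (fun t => 2 * logGap t - (3 * t / (3 + t)) ^ 2)
        (2 * x ^ 3 * (9 + x) / ((1 + x) * (3 + x) ^ 3)) x := by
    have hden : 3 + x ≠ 0 := by positivity
    have hquot := ((hasDerivAt_id x).const_mul 3).div ((hasDerivAt_id x).const_add 3) hden
    refine (((hasDerivAt_logGap (by linarith)).const_mul 2).sub (hquot.pow 2)).congr_deriv ?_
    simp only [id, Pi.div_apply, Nat.cast_ofNat, Nat.add_one_sub_one, pow_one]
    field_simp
    ring
  have hlt := lt_of_hasDerivAt_pos (fun x hx => (hderiv x hx).continuousAt.continuousWithinAt)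
    (fun x hx => hderiv x hx.le) (fun x hx => by positivity) ht
  simpa [logGap_zero] using hlt

theorem two_mul_logGap_lt {t : ℝ} (ht : 0 < t) :
    2 * logGap t < t ^ 2 * (1 + t) ^ (-2 / 3 : ℝ) := by
  have hderiv (x : ℝ) (hx : 0 ≤ x) :
      HasDerivAt (fun t => t ^ 2 * (1 + t) ^ (-2 / 3 : ℝ) - 2 * logGap t)
        (2 * x * (1 + x) ^ (-5 / 3 : ℝ) * (1 + 2 / 3 * x - (1 + x) ^ (2 / 3 : ℝ))) x := by
    have hx₁ : 0 < 1 + x := by positivity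
    have hrpow := ((hasDerivAt_id x).const_add 1).rpow_const (p := (-2 / 3 : ℝ)) (.inl hx₁.ne')
    refine (((hasDerivAt_pow 2 x).mul hrpow).sub
      ((hasDerivAt_logGap (by linarith)).const_mul 2)).congr_deriv ?_
    have hexp₁ : (1 + x) ^ (-2 / 3 : ℝ) = (1 + x) ^ (-5 / 3 : ℝ) * (1 + x) := by
      rw [← Real.rpow_add_one hx₁.ne']
      norm_num
    have hexp₂ : (1 + x) ^ (-5 / 3 : ℝ) * (1 + x) ^ (2 / 3 : ℝ) = (1 + x)⁻¹ := by
      rw [← Real.rpow_add hx₁, ← Real.rpow_neg_one]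
      norm_num
    have hexp₃ : (-2 / 3 - 1 : ℝ) = -5 / 3 := by norm_num
    simp only [id, hexp₁, hexp₃]
    linear_combination (2 * x) * hexp₂
  have hlt := lt_of_hasDerivAt_pos (fun x hx => (hderiv x hx).continuousAt.continuousWithinAt)
    (fun x hx => hderiv x hx.le) (fun x hx => ?_) ht
  · simpa [logGap_zero] using hlt
  · have hbernoulli := rpow_one_add_lt_one_add_mul_self (s := x) (p := 2 / 3) (by linarith)
      hx.ne' (by norm_num) (by norm_num)
    have := sub_pos.2 hbernoulli
    positivity

/-- The coordinate `u(t) = √(2 h(t))` in which the phase is quadratic, `h = u² / 2`. -/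
noncomputable def saddleCoord (t : ℝ) : ℝ := √(2 * logGap t)

theorem saddleCoord_zero : saddleCoord 0 = 0 := by simp [saddleCoord, logGap_zero]

theorem saddleCoord_pos {t : ℝ} (ht : 0 < t) : 0 < saddleCoord t :=
  Real.sqrt_pos.2 (mul_pos two_pos (logGap_pos ht))

theorem saddleCoord_sq {t : ℝ} (ht : 0 < t) : saddleCoord t ^ 2 = 2 * logGap t :=
  Real.sq_sqrt (mul_pos two_pos (logGap_pos ht)).le

theorem hasDerivAt_saddleCoord {t : ℝ} (ht : 0 < t) :
    HasDerivAt saddleCoord (t / ((1 + t) * saddleCoord t)) t := by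
  refine (((hasDerivAt_logGap (by linarith)).const_mul 2).sqrt
    (mul_pos two_pos (logGap_pos ht)).ne').congr_deriv ?_
  rw [← saddleCoord]
  field_simp

theorem continuousOn_saddleCoord : ContinuousOn saddleCoord (Ici 0) := fun _ ht =>
  ((hasDerivAt_logGap (neg_one_lt_zero.trans_le ht)).continuousAt.const_mul
    2).sqrt.continuousWithinAt

theorem strictMonoOn_saddleCoord : StrictMonoOn saddleCoord (Ici 0) := by
  refine strictMonoOn_of_hasDerivWithinAt_pos (f' := fun t => t / ((1 + t) * saddleCoord t))
    (convex_Ici 0) continuousOn_saddleCoord ?_ ?_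
  all_goals rw [interior_Ici]
  · exact fun t ht => (hasDerivAt_saddleCoord ht).hasDerivWithinAt
  · intro t ht
    have := saddleCoord_pos ht
    have : 0 < t := ht
    positivity

theorem tendsto_saddleCoord_atTop : Tendsto saddleCoord atTop atTop :=
  Real.tendsto_sqrt_atTop.comp (tendsto_logGap_atTop.const_mul_atTop two_pos)

theorem image_saddleCoord_Ioi : saddleCoord '' Ioi 0 = Ioi 0 := by
  rw [continuousOn_saddleCoord.image_Ioi_of_strictMonoOn strictMonoOn_saddleCoord
    tendsto_saddleCoord_atTop, saddleCoord_zero]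

theorem lt_saddleCoord {t : ℝ} (ht : 0 < t) : 3 * t / (3 + t) < saddleCoord t :=
  Real.lt_sqrt_of_sq_lt (sq_lt_two_mul_logGap ht)

theorem saddleCoord_mul_rpow_lt {t : ℝ} (ht : 0 < t) :
    saddleCoord t * (1 + t) ^ (1 / 3 : ℝ) < t := by
  have ht₁ : 0 < 1 + t := by positivity
  refine lt_of_pow_lt_pow_left₀ 2 ht.le ?_
  calc (saddleCoord t * (1 + t) ^ (1 / 3 : ℝ)) ^ 2
      = 2 * logGap t * (1 + t) ^ (2 / 3 : ℝ) := by
        rw [mul_pow, saddleCoord_sq ht, ← Real.rpow_mul_natCast ht₁.le]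
        norm_num
    _ < t ^ 2 * (1 + t) ^ (-2 / 3 : ℝ) * (1 + t) ^ (2 / 3 : ℝ) := by
        exact mul_lt_mul_of_pos_right (two_mul_logGap_lt ht) (by positivity)
    _ = t ^ 2 := by
        rw [mul_assoc, ← Real.rpow_add ht₁]
        norm_num

theorem mul_saddleCoord_pow_three_lt {t : ℝ} (ht : 0 < t) :
    (1 + t) * saddleCoord t ^ 3 < t ^ 3 := by
  have hu := saddleCoord_pos ht
  calc (1 + t) * saddleCoord t ^ 3 = (saddleCoord t * (1 + t) ^ (1 / 3 : ℝ)) ^ 3 := by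
        rw [mul_pow, ← Real.rpow_mul_natCast (by positivity)]
        norm_num
        ring
    _ < t ^ 3 := by
        gcongr
        exact saddleCoord_mul_rpow_lt ht

theorem integrableOn_Ioi_mul_comp_saddleCoord {g : ℝ → ℝ} (hg : IntegrableOn g (Ioi 0)) :
    IntegrableOn (fun t => t / ((1 + t) * saddleCoord t) * g (saddleCoord t)) (Ioi 0) := by
  rw [← image_saddleCoord_Ioi] at hg
  exact (integrableOn_image_iff_integrableOn_deriv_smul_of_monotoneOn measurableSet_Ioi
    (fun t ht => (hasDerivAt_saddleCoord ht).hasDerivWithinAt)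
    (strictMonoOn_saddleCoord.mono Ioi_subset_Ici_self).monotoneOn g).1 hg

theorem integral_Ioi_mul_comp_saddleCoord (g : ℝ → ℝ) :
    ∫ t in Ioi 0, t / ((1 + t) * saddleCoord t) * g (saddleCoord t) = ∫ u in Ioi 0, g u := by
  conv_rhs => rw [← image_saddleCoord_Ioi]
  exact (integral_image_eq_integral_deriv_smul_of_monotoneOn measurableSet_Ioi
    (fun t ht => (hasDerivAt_saddleCoord ht).hasDerivWithinAt)
    (strictMonoOn_saddleCoord.mono Ioi_subset_Ici_self).monotoneOn g).symm

/-- The density `x h'(t) exp (-x h(t))` on the positive half-line, with total mass `1`. -/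
noncomputable def saddleDensity (x t : ℝ) : ℝ := x * (t / (1 + t)) * Real.exp (-(x * logGap t))

theorem saddleDensity_nonneg {x t : ℝ} (hx : 0 ≤ x) (ht : 0 ≤ t) : 0 ≤ saddleDensity x t := by
  unfold saddleDensity
  positivity

theorem hasDerivAt_neg_exp_neg_mul_logGap (x : ℝ) {t : ℝ} (ht : -1 < t) :
    HasDerivAt (fun t => -Real.exp (-(x * logGap t))) (saddleDensity x t) t := by
  refine ((hasDerivAt_logGap ht).const_mul x).fun_neg.exp.fun_neg.congr_deriv ?_
  rw [saddleDensity]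
  ring

theorem tendsto_neg_exp_neg_mul_logGap_atTop {x : ℝ} (hx : 0 < x) :
    Tendsto (fun t => -Real.exp (-(x * logGap t))) atTop (𝓝 0) := by
  simpa using (Real.tendsto_exp_neg_atTop_nhds_zero.comp
    (tendsto_logGap_atTop.const_mul_atTop hx)).neg

theorem integrableOn_saddleDensity {x : ℝ} (hx : 0 < x) : IntegrableOn (saddleDensity x) (Ioi 0) :=
  integrableOn_Ioi_deriv_of_nonneg'
    (fun _ ht => hasDerivAt_neg_exp_neg_mul_logGap x (neg_one_lt_zero.trans_le ht))
    (fun _ ht => saddleDensity_nonneg hx.le (le_of_lt ht)) (tendsto_neg_exp_neg_mul_logGap_atTop hx)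

theorem integral_saddleDensity {x : ℝ} (hx : 0 < x) : ∫ t in Ioi 0, saddleDensity x t = 1 := by
  rw [integral_Ioi_of_hasDerivAt_of_nonneg'
    (fun _ ht => hasDerivAt_neg_exp_neg_mul_logGap x (neg_one_lt_zero.trans_le ht))
    (fun _ ht => saddleDensity_nonneg hx.le (le_of_lt ht))
    (tendsto_neg_exp_neg_mul_logGap_atTop hx)]
  simp [logGap_zero]

theorem saddleDensity_div_saddleCoord (x : ℝ) {t : ℝ} (ht : 0 < t) :
    saddleDensity x t / saddleCoord t =
      x * (t / ((1 + t) * saddleCoord t) * Real.exp (-(x / 2) * saddleCoord t ^ 2)) := by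
  have hexp : -(x / 2) * saddleCoord t ^ 2 = -(x * logGap t) := by
    rw [saddleCoord_sq ht]
    ring
  rw [hexp, saddleDensity]
  field_simp

theorem integrableOn_saddleDensity_div_saddleCoord {x : ℝ} (hx : 0 < x) :
    IntegrableOn (fun t => saddleDensity x t / saddleCoord t) (Ioi 0) :=
  IntegrableOn.congr_fun ((integrableOn_Ioi_mul_comp_saddleCoord
    (integrable_exp_neg_mul_sq (half_pos hx)).integrableOn).const_mul x)
    (fun _ ht => (saddleDensity_div_saddleCoord x ht).symm) measurableSet_Ioi

theorem integral_saddleDensity_div_saddleCoord {x : ℝ} (hx : 0 < x) :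
    ∫ t in Ioi 0, saddleDensity x t / saddleCoord t = √(Real.pi * x / 2) := by
  rw [setIntegral_congr_fun measurableSet_Ioi fun _ ht => saddleDensity_div_saddleCoord x ht,
    integral_const_mul, integral_Ioi_mul_comp_saddleCoord fun u => Real.exp (-(x / 2) * u ^ 2),
    integral_gaussian_Ioi]
  have hscale : Real.pi / (x / 2) = Real.pi * x / 2 * (2 / x) ^ 2 := by
    field_simp
  rw [hscale, Real.sqrt_mul (by positivity), Real.sqrt_sq (by positivity)]
  field_simp

/-- The error `ψ = 1 / t - (1 / u - 1 / 3)` of the two-term expansion of `1 / t` in the coordinate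
`u = saddleCoord t` at the saddle point `t = 0`. -/
noncomputable def saddleRemainder (t : ℝ) : ℝ := 1 / t - 1 / saddleCoord t + 1 / 3

theorem hasDerivAt_saddleRemainder {t : ℝ} (ht : 0 < t) :
    HasDerivAt saddleRemainder (t / ((1 + t) * saddleCoord t ^ 3) - 1 / t ^ 2) t := by
  have hu := saddleCoord_pos ht
  have hinv := ((hasDerivAt_inv ht.ne').sub ((hasDerivAt_saddleCoord ht).inv hu.ne')).add_const
    (1 / 3 : ℝ)
  refine (hinv.congr_deriv ?_).congr_of_eventuallyEq (.of_eq ?_)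
  · field_simp
    ring
  · ext t
    simp [saddleRemainder]

theorem continuousOn_saddleRemainder : ContinuousOn saddleRemainder (Ioi 0) := fun _ ht =>
  (hasDerivAt_saddleRemainder ht).continuousAt.continuousWithinAt

theorem hasDerivAt_saddleRemainder_deriv {t : ℝ} (ht : 0 < t) :
    HasDerivAt saddleRemainder (deriv saddleRemainder t) t :=
  (hasDerivAt_saddleRemainder ht).differentiableAt.hasDerivAt

theorem deriv_saddleRemainder_pos {t : ℝ} (ht : 0 < t) : 0 < deriv saddleRemainder t := by
  have hu := saddleCoord_pos ht
  rw [(hasDerivAt_saddleRemainder ht).deriv, sub_pos,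
    div_lt_div_iff₀ (by positivity) (by positivity)]
  linarith [mul_saddleCoord_pow_three_lt ht]

theorem saddleRemainder_pos {t : ℝ} (ht : 0 < t) : 0 < saddleRemainder t := by
  have hinv : 1 / saddleCoord t < 1 / (3 * t / (3 + t)) :=
    one_div_lt_one_div_of_lt (by positivity) (lt_saddleCoord ht)
  have hsplit : 1 / (3 * t / (3 + t)) = 1 / t + 1 / 3 := by field_simp
  rw [saddleRemainder]
  linarith

theorem saddleRemainder_lt {t : ℝ} (ht : 0 < t) :
    saddleRemainder t < 1 / 3 - ((1 + t) ^ (1 / 3 : ℝ) - 1) / t := by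
  have hinv : (1 + t) ^ (1 / 3 : ℝ) / t < 1 / saddleCoord t := by
    rw [div_lt_div_iff₀ ht (saddleCoord_pos ht)]
    linarith [saddleCoord_mul_rpow_lt ht]
  rw [saddleRemainder, sub_div]
  linarith

theorem saddleRemainder_lt_third {t : ℝ} (ht : 0 < t) : saddleRemainder t < 1 / 3 := by
  have hrpow : 1 ≤ (1 + t) ^ (1 / 3 : ℝ) := Real.one_le_rpow (by linarith) (by norm_num)
  have hslope := div_nonneg (sub_nonneg.2 hrpow) ht.le
  linarith [saddleRemainder_lt ht]

theorem tendsto_saddleRemainder_zero : Tendsto saddleRemainder (𝓝[>] 0) (𝓝 0) := by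
  have hderiv : HasDerivAt (fun t : ℝ => (1 + t) ^ (1 / 3 : ℝ)) (1 / 3) 0 := by
    simpa using ((hasDerivAt_id (0 : ℝ)).const_add 1).rpow_const (p := 1 / 3) (by simp)
  have hslope : Tendsto (fun t : ℝ => 1 / 3 - ((1 + t) ^ (1 / 3 : ℝ) - 1) / t)
      (𝓝[>] 0) (𝓝 0) := by
    have hsub := hderiv.tendsto_slope_zero_right.const_sub (1 / 3)
    rw [sub_self] at hsub
    refine hsub.congr fun t => ?_
    simp only [zero_add, add_zero, Real.one_rpow, smul_eq_mul, inv_mul_eq_div]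
  refine tendsto_of_tendsto_of_tendsto_of_le_of_le' tendsto_const_nhds hslope ?_ ?_
  · exact eventually_mem_nhdsWithin.mono fun t ht => (saddleRemainder_pos ht).le
  · exact eventually_mem_nhdsWithin.mono fun t ht => (saddleRemainder_lt ht).le

theorem tendsto_saddleRemainder_atTop : Tendsto saddleRemainder atTop (𝓝 (1 / 3)) := by
  have hinv := tendsto_inv_atTop_zero.sub tendsto_saddleCoord_atTop.inv_tendsto_atTop
  have hsum := hinv.add_const (1 / 3 : ℝ)
  rw [sub_zero, zero_add] at hsum
  exact hsum.congr fun t => by simp [saddleRemainder]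

theorem integrableOn_deriv_saddleRemainder : IntegrableOn (deriv saddleRemainder) (Ioi 0) :=
  integrableOn_Ioi_deriv_of_nonneg_of_tendsto (fun _ ht => hasDerivAt_saddleRemainder_deriv ht)
    (fun _ ht => (deriv_saddleRemainder_pos ht).le) tendsto_saddleRemainder_zero
    tendsto_saddleRemainder_atTop

/-- The Laplace transform in `h` of `ψ'`, which extends `κ` to the positive reals. -/
noncomputable def kappaIntegral (x : ℝ) : ℝ :=
  ∫ t in Ioi 0, deriv saddleRemainder t * Real.exp (-(x * logGap t))

theorem strictAntiOn_kappaIntegral : StrictAntiOn kappaIntegral (Ici 0) :=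
  have : NeZero (volume.restrict (Ioi (0 : ℝ))) := ⟨by simp⟩
  strictAntiOn_integral_mul_exp_neg_mul integrableOn_deriv_saddleRemainder
    measurable_logGap.aemeasurable
    (ae_restrict_of_forall_mem measurableSet_Ioi fun _ ht => deriv_saddleRemainder_pos ht)
    (ae_restrict_of_forall_mem measurableSet_Ioi fun _ ht => logGap_pos ht)

theorem tendsto_kappaIntegral : Tendsto kappaIntegral atTop (𝓝 0) :=
  tendsto_integral_mul_exp_neg_mul integrableOn_deriv_saddleRemainder
    measurable_logGap.aemeasurable
    (ae_restrict_of_forall_mem measurableSet_Ioi fun _ ht => logGap_pos ht)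

theorem integrableOn_saddleRemainder_mul_saddleDensity {x : ℝ} (hx : 0 < x) :
    IntegrableOn (fun t => saddleRemainder t * saddleDensity x t) (Ioi 0) := by
  refine (integrableOn_saddleDensity hx).bdd_mul (c := 1 / 3)
    (continuousOn_saddleRemainder.aestronglyMeasurable measurableSet_Ioi)
    (ae_restrict_of_forall_mem measurableSet_Ioi fun t ht => ?_)
  rw [Real.norm_of_nonneg (saddleRemainder_pos ht).le]
  exact (saddleRemainder_lt_third ht).le

theorem integral_saddleRemainder_mul_saddleDensity {x : ℝ} (hx : 0 < x) :
    ∫ t in Ioi 0, saddleRemainder t * saddleDensity x t = kappaIntegral x := by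
  have hlogGap : ∀ᵐ t ∂volume.restrict (Ioi 0), 0 ≤ logGap t :=
    ae_restrict_of_forall_mem measurableSet_Ioi fun _ ht => (logGap_pos ht).le
  have hintegrable : IntegrableOn (fun t => deriv saddleRemainder t * -Real.exp (-(x * logGap t)))
      (Ioi 0) := by
    simpa only [mul_neg] using! (integrable_mul_exp_neg_mul integrableOn_deriv_saddleRemainder
      measurable_logGap.aemeasurable hlogGap hx.le).neg
  have hexp_zero : Tendsto (fun t => -Real.exp (-(x * logGap t))) (𝓝[>] 0) (𝓝 (-1)) := by
    simpa [ContinuousAt, logGap_zero] using (hasDerivAt_neg_exp_neg_mul_logGap x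
      neg_one_lt_zero).continuousAt.tendsto.mono_left nhdsWithin_le_nhds
  have hparts := integral_Ioi_mul_deriv_eq_deriv_mul
    (fun _ ht => hasDerivAt_saddleRemainder_deriv ht)
    (fun _ ht => hasDerivAt_neg_exp_neg_mul_logGap x (neg_one_lt_zero.trans ht))
    (integrableOn_saddleRemainder_mul_saddleDensity hx) hintegrable
    (tendsto_saddleRemainder_zero.mul hexp_zero)
    (tendsto_saddleRemainder_atTop.mul (tendsto_neg_exp_neg_mul_logGap_atTop hx))
  simpa [integral_neg, kappaIntegral] using hparts

theorem kappaIntegral_eq {x : ℝ} (hx : 0 < x) :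
    kappaIntegral x = (∫ t in Ioi 0, saddleDensity x t / t) - √(Real.pi * x / 2) + 1 / 3 := by
  have hremainder := integrableOn_saddleRemainder_mul_saddleDensity hx
  have hcoord := integrableOn_saddleDensity_div_saddleCoord hx
  have hdiv (t : ℝ) : saddleDensity x t / t = saddleRemainder t * saddleDensity x t +
      saddleDensity x t / saddleCoord t - saddleDensity x t / 3 := by
    rw [saddleRemainder]
    ring
  simp only [hdiv]
  rw [integral_sub (hremainder.fun_add hcoord) ((integrableOn_saddleDensity hx).div_const 3),
    integral_add hremainder hcoord,
    integral_saddleRemainder_mul_saddleDensity hx, integral_saddleDensity_div_saddleCoord hx,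
    integral_div, integral_saddleDensity hx]
  ring

theorem saddleDensity_natCast_div {m : ℕ} {t : ℝ} (ht : 0 < t) :
    saddleDensity (m + 1 : ℕ) t / t =
      (m + 1 : ℕ) * ((1 + t) ^ m * Real.exp (-((m + 1 : ℕ) * t))) := by
  have hexp : Real.exp (-((m + 1 : ℕ) * logGap t)) =
      Real.exp (-((m + 1 : ℕ) * t)) * (1 + t) ^ (m + 1) := by
    have hsplit : -((m + 1 : ℕ) * logGap t) =
        -((m + 1 : ℕ) * t) + (m + 1 : ℕ) * Real.log (1 + t) := by
      rw [logGap]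
      ring
    rw [hsplit, Real.exp_add, Real.exp_nat_mul, Real.exp_log (by positivity)]
  rw [saddleDensity, hexp, pow_succ]
  field_simp

theorem tailProb_succ_succ (m j : ℕ) :
    tailProb (m + 1) (j + 1) =
      (m + 1 : ℕ) * (m.descFactorial j / ((m + 1 : ℕ) : ℝ) ^ (j + 1)) := by
  rw [tailProb, Nat.succ_descFactorial_succ, Nat.cast_mul, mul_div_assoc]

theorem R_one_eq_integral {n : ℕ} (hn : 1 ≤ n) :
    R 1 n = ∫ t in Ioi 0, saddleDensity n t / t := by
  obtain ⟨m, rfl⟩ := Nat.exists_eq_add_of_le' hn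
  calc R 1 (m + 1) = ∑ j ∈ Finset.range (m + 1), tailProb (m + 1) (j + 1) := by
        rw [R_one_eq_sum_tailProb hn, Finset.range_eq_Ico, Finset.sum_Ico_add', zero_add,
          Finset.Ico_add_one_right_eq_Icc]
    _ = (m + 1 : ℕ) * ∫ t in Ioi (0 : ℝ), (1 + t) ^ m * Real.exp (-((m + 1 : ℕ) * t)) := by
        rw [integral_one_add_pow_mul_exp_neg_mul (by positivity), Finset.mul_sum]
        exact Finset.sum_congr rfl fun j _ => tailProb_succ_succ m j
    _ = ∫ t in Ioi 0, saddleDensity (m + 1 : ℕ) t / t := by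
        rw [← integral_const_mul]
        exact setIntegral_congr_fun measurableSet_Ioi fun _ ht =>
          (saddleDensity_natCast_div ht).symm

theorem kappa_eq_kappaIntegral {n : ℕ} (hn : 1 ≤ n) : κ n = kappaIntegral n := by
  rw [kappaIntegral_eq (Nat.cast_pos.2 hn), ← R_one_eq_integral hn, R_one_eq_sqrt_sub_add_kappa hn]
  ring

theorem strictAntiOn_kappa : StrictAntiOn κ (Ici 1) := by
  intro m hm n hn hmn
  rw [kappa_eq_kappaIntegral hm, kappa_eq_kappaIntegral hn]
  exact strictAntiOn_kappaIntegral (mem_Ici.2 m.cast_nonneg) (mem_Ici.2 n.cast_nonneg)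
    (Nat.cast_lt.2 hmn)

theorem tendsto_kappa : Tendsto κ atTop (𝓝 0) := by
  refine (tendsto_kappaIntegral.comp tendsto_natCast_atTop_atTop).congr' ?_
  filter_upwards [eventually_ge_atTop 1] with n hn
  exact (kappa_eq_kappaIntegral hn).symm

end RamanujanQ

theorem lemma7 :
    (∀ n : ℕ, 1 ≤ n →
      RamanujanQ.R 1 n = (n ! : ℝ) / (n : ℝ) ^ n * RamanujanQ.S 0 n ∧
      RamanujanQ.R 1 n = √(Real.pi * n / 2) - 1 / 3 + RamanujanQ.κ n) ∧
    StrictAntiOn RamanujanQ.κ (Set.Ici 1) ∧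
    Tendsto RamanujanQ.κ atTop (𝓝 0) :=
  ⟨fun _ hn => ⟨RamanujanQ.R_one_eq_factorial_div_mul_S hn,
    RamanujanQ.R_one_eq_sqrt_sub_add_kappa hn⟩,
    RamanujanQ.strictAntiOn_kappa, RamanujanQ.tendsto_kappa⟩
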